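/- Consider a finite discounted MDP with non-empty state space $\mathcal S$ and action space $\mathcal A$, transition probabilities $P(s'\mid s,a)$, real rewards $r(s,a,s')$, expected rewards $R(s,a)=\sum_{s'}P(s'\mid s,a)r(s,a,s')$, $R_{\max}=\max|r(s,a,s')|$ and discount factor $\gamma\in(0,1)$. Let $\Phi\in\mathbb R^{|\mathcal S||\mathcal A|\times m}$ be a feature matrix of full column rank with rows $\phi(s,a)^\top$, let $\phi_{\max}=\max_{s,a}\|\phi(s,a)\|_2$ and $V_\theta(s)=\max_a\phi(s,a)^\top\theta$. Let $b(a\mid s)$ be a behavior policy, and let $d$ be a stationary distribution of the state-action chain with kernel $P^b(s',a'\mid s,a)=P(s'\mid s,a)\,b(a'\mid s')$, with $d(s,a)>0$ for all $(s,a)$; put $D=\operatorname{diag}(d)$. Let $\alpha\in(0,1)$. For a deterministic policy $\pi:\mathcal S\to\mathcal A$ let $\Pi^\pi$ be the matrix with $(\Pi^\pi Q)(s)=Q(s,\pi(s))$, and let $A_\pi=I-\alpha\Phi^\top D\Phi+\alpha\gamma\,\Phi^\top DP\,\Pi^\pi\Phi$. Let $\rho_\alpha^{\mathrm{dir}}=\lim_{k}\max_{\pi_1,\dots,\pi_k}\|A_{\pi_k}\cdots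 A_{\pi_1}\|_2^{1/k}$ be the joint spectral radius of $\{A_\pi\}_\pi$. Assume $\rho_\alpha^{\mathrm{dir}}<1$ and fix $\varepsilon>0$ with $\beta_\varepsilon:=\rho_\alpha^{\mathrm{dir}}+\varepsilon<1$. Put $$V_\varepsilon^t(x)=\sum_{\ell=0}^{t}\beta_\varepsilon^{-2\ell}\max_{\pi_1,\dots,\pi_\ell}\|A_{\pi_\ell}\cdots A_{\pi_1}x\|_2^2 .$$ Then the limit $V_\varepsilon^\infty(x)=\lim_{t\to\infty} V_\varepsilon^t(x)$ exists for every $x\in\mathbb R^m$, $p_\varepsilon:=\sqrt{V_\varepsilon^\infty}$ is a norm on $\mathbb R^m$, there is a constant $C_\varepsilon\ge1$ with $\|x\|_2^2\le V_\varepsilon^\infty(x)\le C_\varepsilon\|x\|_2^2$ for all $x$, and there is a unique $\theta^\star$ that solves the projected Bellman equation $\Phi\theta^\star=\Phi(\Phi^\top D\Phi)^{-1}\Phi^\top D\,(R+\gamma PV_{\theta^\star})$. Let $(s_k,a_k)_{k\ge0}$ be a Markov chain with kernel $P^b$ and arbitrary initial law (a single trajectory), let $\theta_0$ be deterministic, and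 let $$\theta_{k+1}=\theta_k+\alpha\,\phi(s_k,a_k)\Big(r(s_k,a_k,s_{k+1})+\gamma\max_{u}\phi(s_{k+1},u)^\top\theta_k-\phi(s_k,a_k)^\top\theta_k\Big).$$ For any constant $C_\varepsilon$ as above put $x_k=\theta_k-\theta^\star$, $$\lambda_\varepsilon=\beta_\varepsilon+4\alpha\sqrt{C_\varepsilon}(1+\gamma)\phi_{\max}^2,\qquad c=2\alpha\sqrt{C_\varepsilon}\,\phi_{\max}\Big(R_{\max}+(1+\gamma)\|\Phi\theta^\star\|_\infty+\|R+\gamma PV_{\theta^\star}-\Phi\theta^\star\|_\infty\Big).$$ Then $p_\varepsilon(x_k)$, $\|x_k\|_2$ and $\|\Phi x_k\|_2$ are integrable for all $k\ge0$, and the following hold. (a) Whatever the value of $\lambda_\varepsilon$, for all $k\ge0$, $$\mathbb E[p_\varepsilon(x_k)]\le\lambda_\varepsilon^k\,p_\varepsilon(x_0)+c\sum_{j=0}^{k-1}\lambda_\varepsilon^j,\qquad \mathbb E\|x_k\|_2\le\sqrt{C_\varepsilon}\,\lambda_\varepsilon^k\|x_0\|_2+c\sum_{j=0}^{k-1}\lambda_\varepsilon^j,$$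 $$\mathbb E\|\Phi x_k\|_2\le\|\Phi\|_2\Big(\sqrt{C_\varepsilon}\,\lambda_\varepsilon^k\|x_0\|_2+c\sum_{j=0}^{k-1}\lambda_\varepsilon^j\Big).$$ (b) If $\lambda_\varepsilon<1$, then for all $k\ge0$, $$\mathbb E[p_\varepsilon(x_k)]\le\lambda_\varepsilon^k\,p_\varepsilon(x_0)+\frac{c}{1-\lambda_\varepsilon}\,(1-\lambda_\varepsilon^k),\qquad \mathbb E\|x_k\|_2\le\sqrt{C_\varepsilon}\,\lambda_\varepsilon^k\|x_0\|_2+\frac{c}{1-\lambda_\varepsilon},$$ $$\limsup_{k\to\infty}\mathbb E\|x_k\|_2\le\frac{c}{1-\lambda_\varepsilon},\qquad \mathbb E\|\Phi x_k\|_2\le\|\Phi\|_2\Big(\sqrt{C_\varepsilon}\,\lambda_\varepsilon^k\|x_0\|_2+\frac{c}{1-\lambda_\varepsilon}\Big).$$ (Remark, not part of the theorem: when $m\ge1$ one always has $\lambda_\varepsilon>1$, so that (b) then has no instances and (a) carries the content.) -/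

import Mathlib

open Filter Topology MeasureTheory Matrix

noncomputable section

namespace LinearQ

/-- A finite discounted Markov decision process: transition probabilities `P s a s'`,
one-step rewards `r s a s'`, discount factor `γ`. -/
structure MDP (S A : Type*) [Fintype S] where
  P : S → A → S → ℝ
  P_nonneg : ∀ s a s', 0 ≤ P s a s'
  P_sum : ∀ s a, ∑ s', P s a s' = 1
  r : S → A → S → ℝ
  γ : ℝ
  γ_pos : 0 < γ
  γ_lt_one : γ < 1

section Matrices

open scoped Matrix.Norms.L2Operator

/-- The spectral norm (operator norm induced by the Euclidean norms). -/
def specNorm {ι κ : Type*} [Fintype ι] [Fintype κ] [DecidableEq κ] (B : Matrix ι κ ℝ) : ℝ := ‖B‖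

end Matrices

/-- `wordProd w = w (k-1) * ⋯ * w 1 * w 0`; the empty product is the identity. -/
def wordProd {m k : ℕ} (w : Fin k → Matrix (Fin m) (Fin m) ℝ) : Matrix (Fin m) (Fin m) ℝ :=
  (List.ofFn w).reverse.prod

/-- Joint spectral radius of a (bounded) set of matrices. -/
def jsr {m : ℕ} (H : Set (Matrix (Fin m) (Fin m) ℝ)) : ℝ :=
  limUnder atTop fun k : ℕ =>
    ⨆ w : Fin k → H, specNorm (wordProd fun i => (w i : Matrix (Fin m) (Fin m) ℝ)) ^ (1 / (k : ℝ))

/-- Action of a matrix on Euclidean space. -/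
def act {ι : Type*} {m : ℕ} (B : Matrix ι (Fin m) ℝ) (x : EuclideanSpace ℝ (Fin m)) :
    EuclideanSpace ℝ ι :=
  WithLp.toLp 2 (B *ᵥ x.ofLp)

section Model

variable {S A : Type*} [Fintype S] [Fintype A] [DecidableEq S] [DecidableEq A] {m : ℕ}

/-- Expected one-step reward, a vector indexed by state-action pairs. -/
def rewardVec (M : MDP S A) : S × A → ℝ := fun x => ∑ s', M.P x.1 x.2 s' * M.r x.1 x.2 s'

/-- The state-action to state transition matrix. -/
def transMat (M : MDP S A) : Matrix (S × A) S ℝ := Matrix.of fun x s' => M.P x.1 x.2 s'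

/-- `R_max`, the largest absolute value of a reward. -/
def rewardMax (M : MDP S A) : ℝ := ⨆ z : S × A × S, |M.r z.1 z.2.1 z.2.2|

/-- The feature vector `φ(s,a)`, a row of the feature matrix. -/
def feature (Φ : Matrix (S × A) (Fin m) ℝ) (x : S × A) : EuclideanSpace ℝ (Fin m) :=
  WithLp.toLp 2 (Φ x)

/-- `φ_max`, the largest Euclidean norm of a feature vector. -/
def featureMax (Φ : Matrix (S × A) (Fin m) ℝ) : ℝ := ⨆ x : S × A, ‖feature Φ x‖

/-- `Q_θ = Φ θ`, as a function on state-action pairs (whose norm is the sup norm). -/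
def qFun (Φ : Matrix (S × A) (Fin m) ℝ) (θ : EuclideanSpace ℝ (Fin m)) : S × A → ℝ :=
  Φ *ᵥ θ.ofLp

/-- `V_θ(s) = max_a φ(s,a)ᵀ θ`. -/
def valueFun (Φ : Matrix (S × A) (Fin m) ℝ) (θ : EuclideanSpace ℝ (Fin m)) : S → ℝ :=
  fun s => ⨆ a : A, qFun Φ θ (s, a)

/-- `F(Φθ) = R + γ P V_θ`, the Bellman optimality operator at `Φ θ`. -/
def bellman (M : MDP S A) (Φ : Matrix (S × A) (Fin m) ℝ) (θ : EuclideanSpace ℝ (Fin m)) :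
    S × A → ℝ :=
  rewardVec M + M.γ • (transMat M *ᵥ valueFun Φ θ)

/-- The `D`-orthogonal projection `Φ (Φᵀ D Φ)⁻¹ Φᵀ D` onto the range of `Φ`, `D = diag d`. -/
def projMat (d : S × A → ℝ) (Φ : Matrix (S × A) (Fin m) ℝ) : Matrix (S × A) (S × A) ℝ :=
  Φ * (Φᵀ * Matrix.diagonal d * Φ)⁻¹ * Φᵀ * Matrix.diagonal d

/-- `θ` solves the projected Bellman equation `Φθ = Π_D (R + γ P V_θ)`. -/
def IsProjectedFixedPoint (M : MDP S A) (d : S × A → ℝ) (Φ : Matrix (S × A) (Fin m) ℝ)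
    (θ : EuclideanSpace ℝ (Fin m)) : Prop :=
  qFun Φ θ = projMat d Φ *ᵥ bellman M Φ θ

/-- The matrix `Π^π` of a deterministic stationary policy `π`. -/
def policyMat (π : S → A) : Matrix S (S × A) ℝ :=
  Matrix.of fun s x => if x = (s, π s) then 1 else 0

/-- The mode `A_π = I - α Φᵀ D Φ + α γ Φᵀ D P Π^π Φ`. -/
def mode (M : MDP S A) (d : S × A → ℝ) (Φ : Matrix (S × A) (Fin m) ℝ) (α : ℝ) (π : S → A) :
    Matrix (Fin m) (Fin m) ℝ :=
  1 - α • (Φᵀ * Matrix.diagonal d * Φ)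
    + (α * M.γ) • (Φᵀ * Matrix.diagonal d * transMat M * policyMat π * Φ)

/-- `ρ_α^dir`, the joint spectral radius of the modes of all deterministic policies. -/
def rhoDir (M : MDP S A) (d : S × A → ℝ) (Φ : Matrix (S × A) (Fin m) ℝ) (α : ℝ) : ℝ :=
  jsr (Set.range (mode M d Φ α))

/-- `β_ε = ρ_α^dir + ε`. -/
def beta (M : MDP S A) (d : S × A → ℝ) (Φ : Matrix (S × A) (Fin m) ℝ) (α ε : ℝ) : ℝ :=
  rhoDir M d Φ α + ε

/-- `V_ε^t(x) = ∑_{ℓ ≤ t} β_ε^{-2ℓ} max_{π_1,…,π_ℓ} ‖A_{π_ℓ} ⋯ A_{π_1} x‖²`. -/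
def lyapPartial (M : MDP S A) (d : S × A → ℝ) (Φ : Matrix (S × A) (Fin m) ℝ) (α ε : ℝ) (t : ℕ)
    (x : EuclideanSpace ℝ (Fin m)) : ℝ :=
  ∑ ℓ ∈ Finset.range (t + 1), (beta M d Φ α ε ^ (2 * ℓ))⁻¹ *
    ⨆ π : Fin ℓ → S → A, ‖act (wordProd fun i => mode M d Φ α (π i)) x‖ ^ 2

/-- `V_ε^∞(x) = lim_t V_ε^t(x)`. -/
def lyap (M : MDP S A) (d : S × A → ℝ) (Φ : Matrix (S × A) (Fin m) ℝ) (α ε : ℝ)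
    (x : EuclideanSpace ℝ (Fin m)) : ℝ :=
  limUnder atTop fun t : ℕ => lyapPartial M d Φ α ε t x

/-- `p_ε = √(V_ε^∞)`. -/
def lyapNorm (M : MDP S A) (d : S × A → ℝ) (Φ : Matrix (S × A) (Fin m) ℝ) (α ε : ℝ)
    (x : EuclideanSpace ℝ (Fin m)) : ℝ :=
  √(lyap M d Φ α ε x)

/-- `C ≥ 1` is a constant with `‖x‖² ≤ V_ε^∞(x) ≤ C ‖x‖²` for all `x`. -/
def IsEquivConst (M : MDP S A) (d : S × A → ℝ) (Φ : Matrix (S × A) (Fin m) ℝ) (α ε C : ℝ) : Prop :=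
  1 ≤ C ∧ ∀ x : EuclideanSpace ℝ (Fin m),
    ‖x‖ ^ 2 ≤ lyap M d Φ α ε x ∧ lyap M d Φ α ε x ≤ C * ‖x‖ ^ 2

/-- `λ_ε = β_ε + 4 α √C_ε (1 + γ) φ_max²`. -/
def lam (M : MDP S A) (d : S × A → ℝ) (Φ : Matrix (S × A) (Fin m) ℝ) (α ε C : ℝ) : ℝ :=
  beta M d Φ α ε + 4 * α * √C * (1 + M.γ) * featureMax Φ ^ 2

/-- `2 α √C_ε φ_max (R_max + (1+γ) ‖Φθ‖_∞ + ‖R + γ P V_θ - Φθ‖_∞)`. -/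
def residual (M : MDP S A) (Φ : Matrix (S × A) (Fin m) ℝ) (α C : ℝ)
    (θ : EuclideanSpace ℝ (Fin m)) : ℝ :=
  2 * α * √C * featureMax Φ *
    (rewardMax M + (1 + M.γ) * ‖qFun Φ θ‖ + ‖bellman M Φ θ - qFun Φ θ‖)

/-- A (stochastic) behavior policy: `b s` is a probability vector on actions. -/
def IsPolicy (b : S → A → ℝ) : Prop :=
  (∀ s a, 0 ≤ b s a) ∧ ∀ s, ∑ a, b s a = 1

/-- The state-action kernel `P^b(s',a' | s,a) = P(s' | s,a) b(a' | s')`. -/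
def chainKernel (M : MDP S A) (b : S → A → ℝ) (x y : S × A) : ℝ :=
  M.P x.1 x.2 y.1 * b y.1 y.2

/-- `d` is a stationary probability distribution of the state-action chain. -/
def IsStationary (M : MDP S A) (b : S → A → ℝ) (d : S × A → ℝ) : Prop :=
  (∀ x, 0 ≤ d x) ∧ ∑ x, d x = 1 ∧ ∀ y, ∑ x, d x * chainKernel M b x y = d y

/-- `X` is a Markov chain on state-action pairs with transition kernel `P^b`; its initial law is
arbitrary. -/
def IsTrajectory {Ω : Type*} [MeasurableSpace Ω] (ℙ : Measure Ω) (M : MDP S A) (b : S → A → ℝ)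
    (X : ℕ → Ω → S × A) : Prop :=
  (∀ k y, MeasurableSet {ω | X k ω = y}) ∧
  ∀ (k : ℕ) (x : ℕ → S × A),
    ℙ.real {ω | ∀ j ≤ k + 1, X j ω = x j}
      = ℙ.real {ω | ∀ j ≤ k, X j ω = x j} * chainKernel M b (x k) (x (k + 1))

/-- The linear Q-learning iterates along a state-action path `x`, from the parameter `θ₀`. -/
def iterates (M : MDP S A) (Φ : Matrix (S × A) (Fin m) ℝ) (α : ℝ) (θ₀ : EuclideanSpace ℝ (Fin m))
    (x : ℕ → S × A) : ℕ → EuclideanSpace ℝ (Fin m)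
  | 0 => θ₀
  | k + 1 =>
    let θ := iterates M Φ α θ₀ x k
    θ + (α * (M.r (x k).1 (x k).2 (x (k + 1)).1 + M.γ * valueFun Φ θ (x (k + 1)).1
      - qFun Φ θ (x k))) • feature Φ (x k)

end Model

/-- `p` is a norm on the real vector space `E`. -/
def IsNorm {E : Type*} [AddCommGroup E] [Module ℝ E] (p : E → ℝ) : Prop :=
  (∀ x, 0 ≤ p x) ∧ (∀ x, p x = 0 ↔ x = 0) ∧ (∀ (c : ℝ) x, p (c • x) = |c| * p x) ∧
    ∀ x y, p (x + y) ≤ p x + p y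

end LinearQ

end

/-! The weighted sum defining `lyap` converges because the largest norm of a product of `k` modes is
submultiplicative in `k`: its `k`-th root tends to the joint spectral radius, which lies below
`beta`, so the terms decay geometrically. The square root is an ℓ² combination of seminorms, hence a
norm by Minkowski. Applying one mode shifts the series by one index, so every mode contracts this
norm by the factor `beta`.

The averaged update is nonlinear because of the maximum over actions. Still, the difference of two
greedy value vectors lies in the convex hull of the vectors obtained by evaluating the parameter
difference along deterministic policies. A convex function on such a hull is dominated by its value
at one of the generating points, so the difference of two averaged steps is at most as long as the
image of the parameter difference under a single mode (`lyapNorm_meanStep_sub_le`). The averaged map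
is thus a `beta`-contraction. Its fixed points are the zeros of the mean field, which are the
solutions of the projected Bellman equation; Banach's theorem gives existence and uniqueness.

A sampled step is an averaged step plus `α` times the deviation of the sampled direction from the
mean field. Bounding both directions by norms, affinely in the current error, gives a recursion with
factor `lam` and constant `residual` along every path (`lyapNorm_iterates_succ_le`). Taking
expectations and unrolling it gives all the bounds. -/

namespace LinearQ

/-! ### Submultiplicative sequences and the joint spectral radius -/

/-- Fekete's lemma for nonnegative submultiplicative sequences. -/
theorem exists_tendsto_rpow_of_submultiplicative {a : ℕ → ℝ} (ha : ∀ k, 0 ≤ a k)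
    (hmul : ∀ k l, a (k + l) ≤ a k * a l) :
    ∃ L, 0 ≤ L ∧ Tendsto (fun k : ℕ => a k ^ (1 / (k : ℝ))) atTop (𝓝 L) := by
  -- Entries may vanish, so logarithms are taken of `max (a k) (δ ^ k)`. This is positive and still
  -- submultiplicative, and its `k`-th root is the original root truncated below at `δ`.
  have trunc : ∀ δ : ℝ, 0 < δ → ∃ L, Tendsto (fun k : ℕ => max (a k ^ (1 / (k : ℝ))) δ)
      atTop (𝓝 L) := by
    intro δ hδ
    set c : ℕ → ℝ := fun k => max (a k) (δ ^ k) with hc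
    have cpos : ∀ k, 0 < c k := fun k => lt_max_of_lt_right (pow_pos hδ k)
    have csub : Subadditive fun k => Real.log (c k) := by
      intro k l
      rw [← Real.log_mul (cpos k).ne' (cpos l).ne']
      refine Real.log_le_log (cpos _) (max_le ?_ ?_)
      · exact (hmul k l).trans
          (mul_le_mul (le_max_left _ _) (le_max_left _ _) (ha l) (cpos k).le)
      · rw [pow_add]
        exact mul_le_mul (le_max_right _ _) (le_max_right _ _) (by positivity) (cpos k).le
    have hbdd : BddBelow (Set.range fun k : ℕ => Real.log (c k) / k) := by
      -- The `0` covers the index `k = 0`, where division by zero makes the quotient `0`.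
      refine ⟨min 0 (Real.log δ), ?_⟩
      rintro _ ⟨k, rfl⟩
      rcases Nat.eq_zero_or_pos k with rfl | hk
      · simp
      · refine (min_le_right _ _).trans ?_
        have hk' : (0 : ℝ) < k := by exact_mod_cast hk
        change Real.log δ ≤ Real.log (c k) / k
        rw [le_div_iff₀ hk', mul_comm, ← Real.log_pow]
        exact Real.log_le_log (by positivity) (le_max_right _ _)
    refine ⟨Real.exp csub.lim, ?_⟩
    refine ((Real.continuous_exp.tendsto _).comp (csub.tendsto_lim hbdd)).congr' ?_
    filter_upwards [eventually_gt_atTop 0] with k hk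
    have hk' : (0 : ℝ) < k := by exact_mod_cast hk
    have h1 : Real.exp (Real.log (c k) / k) = c k ^ (1 / (k : ℝ)) := by
      rw [Real.rpow_def_of_pos (cpos k)]; ring_nf
    have h2 : (δ ^ k) ^ (1 / (k : ℝ)) = δ := by
      rw [one_div]; exact Real.pow_rpow_inv_natCast hδ.le hk.ne'
    simp only [Function.comp_apply]
    have hmono : MonotoneOn (fun x : ℝ => x ^ (1 / (k : ℝ))) (Set.Ici 0) :=
      Real.monotoneOn_rpow_Ici_of_exponent_nonneg (by positivity)
    have h3 := hmono.map_max (ha k) (pow_pos hδ k).le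
    simp only [h2] at h3
    exact h1.trans h3
  have hcauchy : CauchySeq fun k : ℕ => a k ^ (1 / (k : ℝ)) := by
    rw [Metric.cauchySeq_iff']
    intro e he
    -- Truncating a nonnegative number at `e / 4` moves it by at most `e / 4`, so the Cauchy
    -- property passes from the truncated roots to the roots themselves.
    obtain ⟨L, hL⟩ := trunc (e / 4) (by positivity)
    obtain ⟨N, hN⟩ := Metric.cauchySeq_iff'.1 hL.cauchySeq (e / 4) (by positivity)
    refine ⟨N, fun n hn => ?_⟩
    have h := hN n hn
    have hnn := Real.rpow_nonneg (ha n) (1 / (n : ℝ))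
    have hNN := Real.rpow_nonneg (ha N) (1 / (N : ℝ))
    rw [Real.dist_eq, abs_lt] at h ⊢
    grind
  obtain ⟨L, hL⟩ := cauchySeq_tendsto_of_complete hcauchy
  exact ⟨L, ge_of_tendsto' hL fun k => Real.rpow_nonneg (ha k) _, hL⟩

section Words

variable {m : ℕ}

theorem specNorm_nonneg {ι κ : Type*} [Fintype ι] [Fintype κ] [DecidableEq κ]
    (B : Matrix ι κ ℝ) : 0 ≤ specNorm B := by
  open scoped Matrix.Norms.L2Operator in exact norm_nonneg B

theorem specNorm_mul_le (B C : Matrix (Fin m) (Fin m) ℝ) :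
    specNorm (B * C) ≤ specNorm B * specNorm C :=
  Matrix.l2_opNorm_mul B C

theorem norm_act_le {ι : Type*} [Fintype ι] (B : Matrix ι (Fin m) ℝ)
    (x : EuclideanSpace ℝ (Fin m)) : ‖act B x‖ ≤ specNorm B * ‖x‖ :=
  Matrix.l2_opNorm_mulVec B x

theorem act_add {ι : Type*} (B : Matrix ι (Fin m) ℝ) (x y : EuclideanSpace ℝ (Fin m)) :
    act B (x + y) = act B x + act B y := by
  simp [act, Matrix.mulVec_add]

theorem act_sub {ι : Type*} (B : Matrix ι (Fin m) ℝ) (x y : EuclideanSpace ℝ (Fin m)) :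
    act B (x - y) = act B x - act B y := by
  simp [act, Matrix.mulVec_sub]

theorem act_smul {ι : Type*} (B : Matrix ι (Fin m) ℝ) (c : ℝ) (x : EuclideanSpace ℝ (Fin m)) :
    act B (c • x) = c • act B x := by
  simp [act, Matrix.mulVec_smul]

theorem act_mul (B C : Matrix (Fin m) (Fin m) ℝ) (x : EuclideanSpace ℝ (Fin m)) :
    act (B * C) x = act B (act C x) := by
  simp [act, Matrix.mulVec_mulVec]

theorem act_one (x : EuclideanSpace ℝ (Fin m)) :
    act (1 : Matrix (Fin m) (Fin m) ℝ) x = x := by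
  simp [act]

theorem wordProd_zero (w : Fin 0 → Matrix (Fin m) (Fin m) ℝ) : wordProd w = 1 := by
  simp [wordProd]

theorem wordProd_succ {k : ℕ} (w : Fin (k + 1) → Matrix (Fin m) (Fin m) ℝ) :
    wordProd w = wordProd (fun i : Fin k => w i.succ) * w 0 := by
  simp [wordProd, List.ofFn_succ]

theorem wordProd_add {k l : ℕ} (w : Fin (k + l) → Matrix (Fin m) (Fin m) ℝ) :
    wordProd w = wordProd (fun i : Fin l => w (Fin.natAdd k i)) *
      wordProd (fun i : Fin k => w (Fin.castAdd l i)) := by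
  simp [wordProd, List.ofFn_add, Fin.castAdd]

/-- The largest spectral norm of a product of `k` matrices of the family `B`. -/
noncomputable def wordNorm {ι : Type*} (B : ι → Matrix (Fin m) (Fin m) ℝ) (k : ℕ) : ℝ :=
  ⨆ w : Fin k → ι, specNorm (wordProd fun i => B (w i))

theorem wordNorm_nonneg {ι : Type*} (B : ι → Matrix (Fin m) (Fin m) ℝ) (k : ℕ) :
    0 ≤ wordNorm B k :=
  Real.iSup_nonneg fun _ => specNorm_nonneg _

variable {ι : Type*} [Finite ι] (B : ι → Matrix (Fin m) (Fin m) ℝ)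

theorem specNorm_wordProd_le {k : ℕ} (w : Fin k → ι) :
    specNorm (wordProd fun i => B (w i)) ≤ wordNorm B k :=
  le_ciSup (f := fun w : Fin k → ι => specNorm (wordProd fun i => B (w i)))
    (Set.finite_range _).bddAbove w

theorem wordNorm_add_le [Nonempty ι] (k l : ℕ) :
    wordNorm B (k + l) ≤ wordNorm B k * wordNorm B l := by
  refine ciSup_le fun w => ?_
  rw [wordProd_add, mul_comm (wordNorm B k)]
  refine (specNorm_mul_le _ _).trans ?_
  exact mul_le_mul (specNorm_wordProd_le B fun i : Fin l => w (Fin.natAdd k i))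
    (specNorm_wordProd_le B fun i : Fin k => w (Fin.castAdd l i)) (specNorm_nonneg _)
    (wordNorm_nonneg B l)

/-- Bridges `jsr`, which ranges over a set of matrices and takes roots inside the supremum, and
`wordNorm`, which ranges over indices. Roots are monotone and the supremum is attained. At `k = 0`
the exponent is `0` and both sides are `1`. -/
theorem iSup_range_eq_wordNorm_rpow [Nonempty ι] (k : ℕ) :
    (⨆ w : Fin k → Set.range B,
      specNorm (wordProd fun i => (w i : Matrix (Fin m) (Fin m) ℝ)) ^ (1 / (k : ℝ))) =
      wordNorm B k ^ (1 / (k : ℝ)) := by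
  have hexp : (0 : ℝ) ≤ 1 / (k : ℝ) := by positivity
  have : Finite (Set.range B) := Set.finite_range B
  apply le_antisymm
  · refine ciSup_le fun w => ?_
    choose v hv using fun i => (w i).2
    refine Real.rpow_le_rpow (specNorm_nonneg _) ?_ hexp
    simp only [← hv]
    exact specNorm_wordProd_le B v
  · obtain ⟨v, hv⟩ := exists_eq_ciSup_of_finite
      (f := fun w : Fin k → ι => specNorm (wordProd fun i => B (w i)))
    have hv' : specNorm (wordProd fun i => B (v i)) = wordNorm B k := hv
    rw [← hv']
    exact le_ciSup (f := fun w : Fin k → Set.range B =>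
      specNorm (wordProd fun i => (w i : Matrix (Fin m) (Fin m) ℝ)) ^ (1 / (k : ℝ)))
      (Set.finite_range _).bddAbove (fun i => ⟨B (v i), Set.mem_range_self _⟩)

/-- The joint spectral radius of a finite family is a limit. -/
theorem tendsto_wordNorm_rpow_jsr [Nonempty ι] :
    Tendsto (fun k : ℕ => wordNorm B k ^ (1 / (k : ℝ))) atTop (𝓝 (jsr (Set.range B))) := by
  obtain ⟨L, -, hL⟩ := exists_tendsto_rpow_of_submultiplicative (wordNorm_nonneg B)
    (wordNorm_add_le B)
  simp only [jsr, iSup_range_eq_wordNorm_rpow]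
  exact hL.limUnder_eq.symm ▸ hL

theorem jsr_nonneg [Nonempty ι] : 0 ≤ jsr (Set.range B) :=
  ge_of_tendsto' (tendsto_wordNorm_rpow_jsr B) fun k => Real.rpow_nonneg (wordNorm_nonneg B k) _

/-- Root test: for `c` strictly between the joint spectral radius and `β`, eventually `wordNorm B k
≤ c ^ k`, and the terms are dominated by a geometric series of ratio `(c / β) ^ 2`. -/
theorem summable_wordNorm_sq [Nonempty ι] {β : ℝ} (hβ : jsr (Set.range B) < β) :
    Summable fun k : ℕ => (β ^ (2 * k))⁻¹ * wordNorm B k ^ 2 := by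
  obtain ⟨c, hc, hcβ⟩ := exists_between hβ
  have hc0 : 0 < c := (jsr_nonneg B).trans_lt hc
  have hβ0 : 0 < β := hc0.trans hcβ
  have hgeo : Summable fun k : ℕ => ((c / β) ^ 2) ^ k :=
    summable_geometric_of_lt_one (by positivity)
      (pow_lt_one₀ (by positivity) ((div_lt_one hβ0).2 hcβ) two_ne_zero)
  refine hgeo.of_norm_bounded_eventually_nat ?_
  filter_upwards [(tendsto_wordNorm_rpow_jsr B).eventually_lt_const hc, eventually_gt_atTop 0]
    with k hk hk0
  have hle : wordNorm B k ≤ c ^ k := by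
    have := pow_le_pow_left₀ (Real.rpow_nonneg (wordNorm_nonneg B k) _) hk.le k
    rwa [one_div, Real.rpow_inv_natCast_pow (wordNorm_nonneg B k) hk0.ne'] at this
  have h0 := wordNorm_nonneg B k
  rw [Real.norm_of_nonneg (by positivity)]
  calc (β ^ (2 * k))⁻¹ * wordNorm B k ^ 2 ≤ (β ^ (2 * k))⁻¹ * (c ^ k) ^ 2 := by gcongr
    _ = ((c / β) ^ 2) ^ k := by
      rw [← pow_mul, ← pow_mul, div_pow, mul_comm k 2]; field_simp

end Words

end LinearQ

namespace LinearQ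

/-! ### The Lyapunov norm and its contraction under every mode -/

section WordSup

variable {m : ℕ} {ι : Type*}

/-- The largest norm of the image of `x` under a product of `k` matrices of the family `B`. -/
noncomputable def wordSup (B : ι → Matrix (Fin m) (Fin m) ℝ) (k : ℕ)
    (x : EuclideanSpace ℝ (Fin m)) : ℝ :=
  ⨆ w : Fin k → ι, ‖act (wordProd fun i => B (w i)) x‖

theorem wordSup_nonneg (B : ι → Matrix (Fin m) (Fin m) ℝ) (k : ℕ)
    (x : EuclideanSpace ℝ (Fin m)) : 0 ≤ wordSup B k x :=
  Real.iSup_nonneg fun _ => norm_nonneg _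

theorem wordSup_zero (B : ι → Matrix (Fin m) (Fin m) ℝ) (x : EuclideanSpace ℝ (Fin m)) :
    wordSup B 0 x = ‖x‖ := by
  simp [wordSup, wordProd_zero, act_one]

theorem wordSup_smul (B : ι → Matrix (Fin m) (Fin m) ℝ) (k : ℕ) (c : ℝ)
    (x : EuclideanSpace ℝ (Fin m)) : wordSup B k (c • x) = |c| * wordSup B k x := by
  simp only [wordSup, act_smul, norm_smul, Real.norm_eq_abs]
  exact (Real.mul_iSup_of_nonneg (abs_nonneg c) _).symm

variable [Finite ι] (B : ι → Matrix (Fin m) (Fin m) ℝ)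

theorem norm_act_wordProd_le {k : ℕ} (w : Fin k → ι) (x : EuclideanSpace ℝ (Fin m)) :
    ‖act (wordProd fun i => B (w i)) x‖ ≤ wordSup B k x :=
  le_ciSup (f := fun w : Fin k → ι => ‖act (wordProd fun i => B (w i)) x‖)
    (Set.finite_range _).bddAbove w

variable [Nonempty ι]

theorem iSup_norm_act_sq (k : ℕ) (x : EuclideanSpace ℝ (Fin m)) :
    (⨆ w : Fin k → ι, ‖act (wordProd fun i => B (w i)) x‖ ^ 2) = wordSup B k x ^ 2 := by
  apply le_antisymm
  · exact ciSup_le fun w =>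
      pow_le_pow_left₀ (norm_nonneg _) (norm_act_wordProd_le B w x) 2
  · obtain ⟨v, hv⟩ := exists_eq_ciSup_of_finite
      (f := fun w : Fin k → ι => ‖act (wordProd fun i => B (w i)) x‖)
    have hv' : ‖act (wordProd fun i => B (v i)) x‖ = wordSup B k x := hv
    rw [← hv']
    exact le_ciSup (f := fun w : Fin k → ι => ‖act (wordProd fun i => B (w i)) x‖ ^ 2)
      (Set.finite_range _).bddAbove v

theorem wordSup_le (k : ℕ) (x : EuclideanSpace ℝ (Fin m)) :
    wordSup B k x ≤ wordNorm B k * ‖x‖ :=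
  ciSup_le fun w => (norm_act_le _ x).trans
    (mul_le_mul_of_nonneg_right (specNorm_wordProd_le B w) (norm_nonneg x))

theorem wordSup_add_le (k : ℕ) (x y : EuclideanSpace ℝ (Fin m)) :
    wordSup B k (x + y) ≤ wordSup B k x + wordSup B k y := by
  refine ciSup_le fun w => ?_
  rw [act_add]
  exact (norm_add_le _ _).trans
    (add_le_add (norm_act_wordProd_le B w x) (norm_act_wordProd_le B w y))

/-- A word applied after `B i` is a word one letter longer whose first letter, the one acting first,
is `i`. -/
theorem wordSup_act_le (k : ℕ) (i : ι) (x : EuclideanSpace ℝ (Fin m)) :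
    wordSup B k (act (B i) x) ≤ wordSup B (k + 1) x := by
  refine ciSup_le fun w => ?_
  have h := norm_act_wordProd_le B (Fin.cons i w : Fin (k + 1) → ι) x
  rw [wordProd_succ, act_mul] at h
  simpa using h

theorem summable_wordSup_sq {β : ℝ} (hβ : jsr (Set.range B) < β)
    (x : EuclideanSpace ℝ (Fin m)) :
    Summable fun k : ℕ => (β ^ (2 * k))⁻¹ * wordSup B k x ^ 2 := by
  have hβ0 : 0 < β := (jsr_nonneg B).trans_lt hβ
  refine Summable.of_nonneg_of_le (fun k => by positivity) (fun k => ?_)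
    ((summable_wordNorm_sq B hβ).mul_right (‖x‖ ^ 2))
  rw [mul_assoc, ← mul_pow]
  have := wordSup_nonneg B k x
  have := wordSup_le B k x
  gcongr

end WordSup

section Lyapunov

variable {S A : Type*} [Fintype S] [Fintype A] [DecidableEq S] [DecidableEq A]
  {m : ℕ} (M : MDP S A) (d : S × A → ℝ) (Φ : Matrix (S × A) (Fin m) ℝ) {α ε : ℝ}

theorem lyapNorm_le {C : ℝ} (hC : IsEquivConst M d Φ α ε C) (x : EuclideanSpace ℝ (Fin m)) :
    lyapNorm M d Φ α ε x ≤ √C * ‖x‖ := by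
  refine (Real.sqrt_le_sqrt (hC.2 x).2).trans_eq ?_
  rw [Real.sqrt_mul (zero_le_one.trans hC.1), Real.sqrt_sq (norm_nonneg x)]

variable [Nonempty A]

theorem beta_pos (hε : 0 < ε) : 0 < beta M d Φ α ε :=
  add_pos_of_nonneg_of_pos (jsr_nonneg (mode M d Φ α)) hε

theorem summable_lyap (hε : 0 < ε) (x : EuclideanSpace ℝ (Fin m)) :
    Summable fun k : ℕ => (beta M d Φ α ε ^ (2 * k))⁻¹ * wordSup (mode M d Φ α) k x ^ 2 :=
  summable_wordSup_sq _ (lt_add_of_pos_right _ hε) x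

theorem tendsto_lyapPartial_tsum (hε : 0 < ε) (x : EuclideanSpace ℝ (Fin m)) :
    Tendsto (fun t => lyapPartial M d Φ α ε t x) atTop
      (𝓝 (∑' k : ℕ, (beta M d Φ α ε ^ (2 * k))⁻¹ * wordSup (mode M d Φ α) k x ^ 2)) := by
  have h := (summable_lyap M d Φ (α := α) hε x).hasSum.tendsto_sum_nat.comp
    (tendsto_add_atTop_nat 1)
  simp only [lyapPartial, iSup_norm_act_sq]
  exact h

theorem lyap_eq_tsum (hε : 0 < ε) (x : EuclideanSpace ℝ (Fin m)) :
    lyap M d Φ α ε x =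
      ∑' k : ℕ, (beta M d Φ α ε ^ (2 * k))⁻¹ * wordSup (mode M d Φ α) k x ^ 2 :=
  (tendsto_lyapPartial_tsum M d Φ hε x).limUnder_eq

theorem tendsto_lyapPartial (hε : 0 < ε) (x : EuclideanSpace ℝ (Fin m)) :
    Tendsto (fun t => lyapPartial M d Φ α ε t x) atTop (𝓝 (lyap M d Φ α ε x)) :=
  lyap_eq_tsum M d Φ hε x ▸ tendsto_lyapPartial_tsum M d Φ hε x

/-- The empty word contributes exactly `‖x‖ ^ 2`. Splitting it off gives the lower bound on `lyap`
and exposes the shifted series needed for the contraction. -/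
theorem norm_sq_add_shift_eq_lyap (hε : 0 < ε) (x : EuclideanSpace ℝ (Fin m)) :
    lyap M d Φ α ε x = ‖x‖ ^ 2 + ∑' k : ℕ, (beta M d Φ α ε ^ (2 * (k + 1)))⁻¹ *
      wordSup (mode M d Φ α) (k + 1) x ^ 2 := by
  rw [lyap_eq_tsum M d Φ hε, (summable_lyap M d Φ hε x).tsum_eq_zero_add]
  simp [wordSup_zero]

theorem norm_sq_le_lyap (hε : 0 < ε) (x : EuclideanSpace ℝ (Fin m)) :
    ‖x‖ ^ 2 ≤ lyap M d Φ α ε x := by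
  rw [norm_sq_add_shift_eq_lyap M d Φ hε]
  have := beta_pos M d Φ (α := α) hε
  exact le_add_of_nonneg_right (tsum_nonneg fun k => by positivity)

theorem lyap_nonneg (hε : 0 < ε) (x : EuclideanSpace ℝ (Fin m)) : 0 ≤ lyap M d Φ α ε x :=
  (sq_nonneg _).trans (norm_sq_le_lyap M d Φ hε x)

theorem exists_isEquivConst (hε : 0 < ε) : ∃ C, IsEquivConst M d Φ α ε C := by
  have hs := summable_wordNorm_sq (mode M d Φ α)
    (β := beta M d Φ α ε) (lt_add_of_pos_right _ hε)
  -- For `m ≥ 1` the term `k = 0` already makes the sum at least `1`; the maximum matters only for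
  -- `m = 0`.
  refine ⟨max 1 (∑' k : ℕ, (beta M d Φ α ε ^ (2 * k))⁻¹ * wordNorm (mode M d Φ α) k ^ 2),
    le_max_left _ _, fun x => ⟨norm_sq_le_lyap M d Φ hε x, ?_⟩⟩
  refine le_trans ?_ (mul_le_mul_of_nonneg_right (le_max_right _ _) (sq_nonneg _))
  rw [lyap_eq_tsum M d Φ hε, ← tsum_mul_right]
  refine (summable_lyap M d Φ hε x).tsum_le_tsum (fun k => ?_) (hs.mul_right _)
  rw [mul_assoc, ← mul_pow]
  have := wordSup_nonneg (mode M d Φ α) k x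
  have := wordSup_le (mode M d Φ α) k x
  have := beta_pos M d Φ (α := α) hε
  gcongr

theorem norm_le_lyapNorm (hε : 0 < ε) (x : EuclideanSpace ℝ (Fin m)) :
    ‖x‖ ≤ lyapNorm M d Φ α ε x :=
  Real.le_sqrt_of_sq_le (norm_sq_le_lyap M d Φ hε x)

theorem lyapNorm_smul (hε : 0 < ε) (c : ℝ) (x : EuclideanSpace ℝ (Fin m)) :
    lyapNorm M d Φ α ε (c • x) = |c| * lyapNorm M d Φ α ε x := by
  have h : lyap M d Φ α ε (c • x) = c ^ 2 * lyap M d Φ α ε x := by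
    rw [lyap_eq_tsum M d Φ hε, lyap_eq_tsum M d Φ hε, ← tsum_mul_left]
    refine tsum_congr fun k => ?_
    rw [wordSup_smul, mul_pow, sq_abs]
    ring
  rw [lyapNorm, h, Real.sqrt_mul (sq_nonneg c), Real.sqrt_sq_eq_abs, lyapNorm]

theorem lyapNorm_add_le (hε : 0 < ε) (x y : EuclideanSpace ℝ (Fin m)) :
    lyapNorm M d Φ α ε (x + y) ≤ lyapNorm M d Φ α ε x + lyapNorm M d Φ α ε y := by
  have hβ := beta_pos M d Φ (α := α) hε
  -- `lyapNorm` is the ℓ² norm of the sequence `q x`, and each `q · k` is subadditive, so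
  -- Minkowski's inequality applies.
  set q : EuclideanSpace ℝ (Fin m) → ℕ → ℝ :=
    fun x k => (beta M d Φ α ε ^ k)⁻¹ * wordSup (mode M d Φ α) k x with hq
  have hq0 : ∀ x k, 0 ≤ q x k := fun x k =>
    mul_nonneg (by positivity) (wordSup_nonneg _ _ _)
  have hqq : ∀ x, (fun k => q x k ^ (2 : ℝ)) =
      fun k => (beta M d Φ α ε ^ (2 * k))⁻¹ * wordSup (mode M d Φ α) k x ^ 2 := by
    intro x
    funext k
    rw [Real.rpow_two, hq, mul_pow, inv_pow, ← pow_mul, mul_comm k 2]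
  have hsum : ∀ x, Summable fun k => q x k ^ (2 : ℝ) := fun x => by
    rw [hqq]; exact summable_lyap M d Φ hε x
  have hp : ∀ x, lyapNorm M d Φ α ε x = (∑' k, q x k ^ (2 : ℝ)) ^ (1 / (2 : ℝ)) := fun x => by
    rw [hqq, lyapNorm, Real.sqrt_eq_rpow, lyap_eq_tsum M d Φ hε]
  have hmink := Real.Lp_add_le_tsum_of_nonneg one_le_two (hq0 x) (hq0 y) (hsum x) (hsum y)
  rw [hp, hp, hp]
  refine le_trans (Real.rpow_le_rpow (tsum_nonneg fun k => ?_) ?_ (by norm_num)) hmink.2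
  · exact Real.rpow_nonneg (hq0 _ _) _
  · refine (hsum _).tsum_le_tsum (fun k => ?_) hmink.1
    refine Real.rpow_le_rpow (hq0 _ _) ?_ (by norm_num)
    rw [hq, ← mul_add]
    exact mul_le_mul_of_nonneg_left (wordSup_add_le _ _ _ _) (by positivity)

theorem isNorm_lyapNorm (hε : 0 < ε) : IsNorm (lyapNorm M d Φ α ε) := by
  refine ⟨fun x => Real.sqrt_nonneg _, fun x => ⟨fun h => ?_, fun h => ?_⟩,
    lyapNorm_smul M d Φ hε, lyapNorm_add_le M d Φ hε⟩
  · exact norm_le_zero_iff.1 (h ▸ norm_le_lyapNorm M d Φ hε x)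
  · have := lyapNorm_smul M d Φ (α := α) hε 0 x
    simpa [h] using this

/-- By `wordSup_act_le`, term `k` at the image is at most `beta ^ 2` times term `k + 1` at `x`; the
term of index `0` is simply dropped. -/
theorem lyapNorm_act_mode_le (hε : 0 < ε) (π : S → A) (x : EuclideanSpace ℝ (Fin m)) :
    lyapNorm M d Φ α ε (act (mode M d Φ α π) x) ≤
      beta M d Φ α ε * lyapNorm M d Φ α ε x := by
  have hβ := beta_pos M d Φ (α := α) hε
  refine Real.sqrt_le_iff.2 ⟨mul_nonneg hβ.le (Real.sqrt_nonneg _), ?_⟩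
  rw [mul_pow, lyapNorm, Real.sq_sqrt (lyap_nonneg M d Φ hε x)]
  have hshift := (summable_nat_add_iff 1).2 (summable_lyap M d Φ (α := α) hε x)
  calc lyap M d Φ α ε (act (mode M d Φ α π) x)
      ≤ beta M d Φ α ε ^ 2 * ∑' k : ℕ, (beta M d Φ α ε ^ (2 * (k + 1)))⁻¹ *
          wordSup (mode M d Φ α) (k + 1) x ^ 2 := by
        rw [lyap_eq_tsum M d Φ hε, ← tsum_mul_left]
        refine (summable_lyap M d Φ hε _).tsum_le_tsum (fun k => ?_) (hshift.mul_left _)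
        have h1 : beta M d Φ α ε ^ 2 * ((beta M d Φ α ε ^ (2 * (k + 1)))⁻¹ *
            wordSup (mode M d Φ α) (k + 1) x ^ 2) =
            (beta M d Φ α ε ^ (2 * k))⁻¹ * wordSup (mode M d Φ α) (k + 1) x ^ 2 := by
          rw [mul_add, pow_add]; field_simp
        rw [h1]
        have := wordSup_nonneg (mode M d Φ α) k (act (mode M d Φ α π) x)
        have := wordSup_act_le (mode M d Φ α) k π x
        gcongr
    _ ≤ beta M d Φ α ε ^ 2 * lyap M d Φ α ε x := by
        rw [norm_sq_add_shift_eq_lyap M d Φ hε x]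
        gcongr
        exact le_add_of_nonneg_left (sq_nonneg _)

theorem convexOn_lyapNorm (hε : 0 < ε) : ConvexOn ℝ Set.univ (lyapNorm M d Φ α ε) := by
  refine ⟨convex_univ, fun x _ y _ a b ha hb _ => ?_⟩
  refine (lyapNorm_add_le M d Φ hε _ _).trans_eq ?_
  rw [lyapNorm_smul M d Φ hε, lyapNorm_smul M d Φ hε, abs_of_nonneg ha, abs_of_nonneg hb,
    smul_eq_mul, smul_eq_mul]

end Lyapunov

end LinearQ

namespace LinearQ

/-! ### Greedy values and Lipschitz bounds -/

section Bounds

variable {S A : Type*} {m : ℕ} (Φ : Matrix (S × A) (Fin m) ℝ)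

theorem qFun_sub (θ θ' : EuclideanSpace ℝ (Fin m)) :
    qFun Φ (θ - θ') = qFun Φ θ - qFun Φ θ' := by
  simp [qFun, Matrix.mulVec_sub]

theorem featureMax_nonneg : 0 ≤ featureMax Φ :=
  Real.iSup_nonneg fun _ => norm_nonneg _

theorem rewardMax_nonneg [Fintype S] (M : MDP S A) : 0 ≤ rewardMax M :=
  Real.iSup_nonneg fun _ => abs_nonneg _

theorem le_valueFun [Finite A] (θ : EuclideanSpace ℝ (Fin m)) (s : S) (a : A) :
    qFun Φ θ (s, a) ≤ valueFun Φ θ s :=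
  le_ciSup (f := fun a : A => qFun Φ θ (s, a)) (Set.finite_range _).bddAbove a

/-- Differences of greedy values lie in the range spanned by the action values of the
parameter difference. -/
theorem valueFun_sub_mem_convexHull [Finite A] [Nonempty A] (θ θ' : EuclideanSpace ℝ (Fin m)) (s : S) :
    valueFun Φ θ s - valueFun Φ θ' s ∈
      convexHull ℝ (Set.range fun a => qFun Φ (θ - θ') (s, a)) := by
  obtain ⟨a, ha⟩ := exists_eq_ciSup_of_finite (f := fun a : A => qFun Φ θ (s, a))
  obtain ⟨a', ha'⟩ := exists_eq_ciSup_of_finite (f := fun a : A => qFun Φ θ' (s, a))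
  have hq : qFun Φ θ (s, a) = valueFun Φ θ s := ha
  have hq' : qFun Φ θ' (s, a') = valueFun Φ θ' s := ha'
  -- The action greedy for `θ'` bounds the difference from below, the one greedy for `θ` from above.
  have h1 : qFun Φ (θ - θ') (s, a') ≤ valueFun Φ θ s - valueFun Φ θ' s := by
    rw [qFun_sub, Pi.sub_apply, hq']
    linarith [le_valueFun Φ θ s a']
  have h2 : valueFun Φ θ s - valueFun Φ θ' s ≤ qFun Φ (θ - θ') (s, a) := by
    rw [qFun_sub, Pi.sub_apply, hq]
    linarith [le_valueFun Φ θ' s a]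
  refine segment_subset_convexHull (Set.mem_range_self a') (Set.mem_range_self a) ?_
  rw [segment_eq_Icc (h1.trans h2)]
  exact ⟨h1, h2⟩

variable [Fintype S] [Fintype A] (M : MDP S A)

theorem norm_feature_le (x : S × A) : ‖feature Φ x‖ ≤ featureMax Φ :=
  le_ciSup (f := fun x : S × A => ‖feature Φ x‖) (Set.finite_range _).bddAbove x

theorem abs_reward_le (s : S) (a : A) (s' : S) : |M.r s a s'| ≤ rewardMax M :=
  le_ciSup (f := fun z : S × A × S => |M.r z.1 z.2.1 z.2.2|) (Set.finite_range _).bddAbove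
    (s, a, s')

theorem norm_qFun_le (θ : EuclideanSpace ℝ (Fin m)) : ‖qFun Φ θ‖ ≤ featureMax Φ * ‖θ‖ := by
  refine (pi_norm_le_iff_of_nonneg (mul_nonneg (featureMax_nonneg Φ) (norm_nonneg θ))).2
    fun x => ?_
  have h : qFun Φ θ x = inner ℝ θ (feature Φ x) := by
    simp [qFun, feature, Matrix.mulVec, EuclideanSpace.inner_eq_star_dotProduct]
  rw [h, Real.norm_eq_abs, mul_comm]
  exact (abs_real_inner_le_norm _ _).trans
    (mul_le_mul_of_nonneg_left (norm_feature_le Φ x) (norm_nonneg θ))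

theorem norm_transMat_mulVec_le (v : S → ℝ) : ‖transMat M *ᵥ v‖ ≤ ‖v‖ := by
  refine (pi_norm_le_iff_of_nonneg (norm_nonneg v)).2 fun x => ?_
  calc ‖∑ s', M.P x.1 x.2 s' * v s'‖ ≤ ∑ s', M.P x.1 x.2 s' * ‖v‖ := by
        refine norm_sum_le_of_le _ fun s' _ => ?_
        rw [norm_mul, Real.norm_of_nonneg (M.P_nonneg _ _ _)]
        exact mul_le_mul_of_nonneg_left (norm_le_pi_norm v s') (M.P_nonneg _ _ _)
    _ = ‖v‖ := by rw [← Finset.sum_mul, M.P_sum, one_mul]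

variable [Nonempty A]

theorem norm_valueFun_sub_le (θ θ' : EuclideanSpace ℝ (Fin m)) :
    ‖valueFun Φ θ - valueFun Φ θ'‖ ≤ ‖qFun Φ (θ - θ')‖ := by
  refine (pi_norm_le_iff_of_nonneg (norm_nonneg _)).2 fun s => ?_
  obtain ⟨_, ⟨a, rfl⟩, ha⟩ := (convexOn_norm (convex_univ (𝕜 := ℝ))).exists_ge_of_mem_convexHull
    (Set.subset_univ _) (valueFun_sub_mem_convexHull Φ θ θ' s)
  exact ha.trans (norm_le_pi_norm (qFun Φ (θ - θ')) (s, a))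

theorem abs_valueFun_le (θ : EuclideanSpace ℝ (Fin m)) (s : S) :
    |valueFun Φ θ s| ≤ ‖qFun Φ θ‖ := by
  obtain ⟨a, ha⟩ := exists_eq_ciSup_of_finite (f := fun a : A => qFun Φ θ (s, a))
  have hq : qFun Φ θ (s, a) = valueFun Φ θ s := ha
  rw [← hq]
  exact norm_le_pi_norm (qFun Φ θ) (s, a)

theorem norm_bellman_residual_sub_le (θ θ' : EuclideanSpace ℝ (Fin m)) :
    ‖(bellman M Φ θ - qFun Φ θ) - (bellman M Φ θ' - qFun Φ θ')‖ ≤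
      (1 + M.γ) * (featureMax Φ * ‖θ - θ'‖) := by
  have h : (bellman M Φ θ - qFun Φ θ) - (bellman M Φ θ' - qFun Φ θ') =
      M.γ • (transMat M *ᵥ (valueFun Φ θ - valueFun Φ θ')) - qFun Φ (θ - θ') := by
    rw [qFun_sub, Matrix.mulVec_sub, smul_sub, bellman, bellman]
    abel
  have hq := norm_qFun_le Φ (θ - θ')
  have hv := (norm_transMat_mulVec_le M _).trans (norm_valueFun_sub_le Φ θ θ')
  rw [h]
  refine (norm_sub_le _ _).trans ?_
  rw [norm_smul, Real.norm_of_nonneg M.γ_pos.le]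
  have := mul_le_mul_of_nonneg_left (hv.trans hq) M.γ_pos.le
  linarith

end Bounds

/-! ### The averaged dynamics and its fixed point -/

section MeanField

variable {S A : Type*} [Fintype S] [Fintype A] [DecidableEq S] [DecidableEq A] {m : ℕ}
  (M : MDP S A) (d : S × A → ℝ) (Φ : Matrix (S × A) (Fin m) ℝ)

/-- The expected update direction `Φᵀ D (R + γ P V_θ - Φ θ)`. -/
noncomputable def meanField (θ : EuclideanSpace ℝ (Fin m)) : EuclideanSpace ℝ (Fin m) :=
  WithLp.toLp 2 ((Φᵀ * Matrix.diagonal d) *ᵥ (bellman M Φ θ - qFun Φ θ))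

/-- One step of the averaged dynamics. -/
noncomputable def meanStep (α : ℝ) (θ : EuclideanSpace ℝ (Fin m)) : EuclideanSpace ℝ (Fin m) :=
  θ + α • meanField M d Φ θ

theorem isUnit_det_gram (hΦ : Φ.rank = m) (hd : ∀ x, 0 < d x) :
    IsUnit (Φᵀ * Matrix.diagonal d * Φ).det := by
  have hinj : Function.Injective Φ.mulVec := by
    have hrank : Module.finrank ℝ (LinearMap.range Φ.mulVecLin) = m := hΦ
    have h := LinearMap.finrank_range_add_finrank_ker Φ.mulVecLin
    rw [hrank, Module.finrank_fin_fun] at h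
    have hker : LinearMap.ker Φ.mulVecLin = ⊥ :=
      Submodule.finrank_eq_zero.1 (by omega)
    exact LinearMap.ker_eq_bot.1 hker
  have hpos := (Matrix.PosDef.diagonal hd).conjTranspose_mul_mul_same (B := Φ) hinj
  rw [Matrix.conjTranspose_eq_transpose_of_trivial] at hpos
  exact hpos.det_pos.ne'.isUnit

/-- These are the normal equations: multiplying by `Φᵀ D` cancels the projection, and the invertible
Gram matrix recovers it. -/
theorem isProjectedFixedPoint_iff (hΦ : Φ.rank = m) (hd : ∀ x, 0 < d x)
    (θ : EuclideanSpace ℝ (Fin m)) :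
    IsProjectedFixedPoint M d Φ θ ↔ meanField M d Φ θ = 0 := by
  have hG := isUnit_det_gram d Φ hΦ hd
  have hzero : meanField M d Φ θ = 0 ↔
      (Φᵀ * Matrix.diagonal d) *ᵥ bellman M Φ θ = (Φᵀ * Matrix.diagonal d * Φ) *ᵥ θ.ofLp := by
    rw [meanField, WithLp.toLp_eq_zero, Matrix.mulVec_sub, sub_eq_zero, qFun, Matrix.mulVec_mulVec]
  rw [hzero, IsProjectedFixedPoint, projMat, Matrix.mul_assoc (_ * _) Φᵀ]
  set F := bellman M Φ θ
  set W := Φᵀ * Matrix.diagonal d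
  constructor
  · intro h
    have h' := congrArg (W *ᵥ ·) h
    simp only [qFun, Matrix.mulVec_mulVec] at h'
    rw [h', ← Matrix.mul_assoc W, ← Matrix.mul_assoc W, Matrix.mul_nonsing_inv _ hG, Matrix.one_mul]
  · intro h
    rw [← Matrix.mulVec_mulVec, h, Matrix.mulVec_mulVec, Matrix.mul_assoc,
      Matrix.nonsing_inv_mul _ hG, Matrix.mul_one, qFun]

theorem isFixedPt_meanStep_iff {α : ℝ} (hα : 0 < α) (θ : EuclideanSpace ℝ (Fin m)) :
    Function.IsFixedPt (meanStep M d Φ α) θ ↔ meanField M d Φ θ = 0 := by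
  rw [Function.IsFixedPt, meanStep, add_eq_left, smul_eq_zero, or_iff_right hα.ne']

theorem norm_toLp_mulVec_le (hd : ∀ x, 0 ≤ d x) (hd1 : ∑ x, d x = 1) (u : S × A → ℝ) :
    ‖(WithLp.toLp 2 ((Φᵀ * Matrix.diagonal d) *ᵥ u) : EuclideanSpace ℝ (Fin m))‖ ≤
      featureMax Φ * ‖u‖ := by
  have h : (WithLp.toLp 2 ((Φᵀ * Matrix.diagonal d) *ᵥ u) : EuclideanSpace ℝ (Fin m)) =
      ∑ x, (d x * u x) • feature Φ x := by
    -- `Φᵀ D u` is the `d`-average of the vectors `u x • feature Φ x`, so its norm is at most the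
    -- largest norm among them.
    ext i
    simp only [feature, Matrix.mulVec, dotProduct, Matrix.mul_diagonal, Matrix.transpose_apply,
      WithLp.ofLp_sum, WithLp.ofLp_smul, Finset.sum_apply, Pi.smul_apply, smul_eq_mul]
    exact Finset.sum_congr rfl fun x _ => by ring
  rw [h]
  calc ‖∑ x, (d x * u x) • feature Φ x‖ ≤ ∑ x, d x * (featureMax Φ * ‖u‖) := by
        refine norm_sum_le_of_le _ fun x _ => ?_
        rw [norm_smul, norm_mul, Real.norm_of_nonneg (hd x), mul_assoc, mul_comm (featureMax Φ)]
        exact mul_le_mul_of_nonneg_left (mul_le_mul (norm_le_pi_norm u x) (norm_feature_le Φ x)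
          (norm_nonneg _) (norm_nonneg _)) (hd x)
    _ = featureMax Φ * ‖u‖ := by rw [← Finset.sum_mul, hd1, one_mul]

theorem policyMat_mulVec (π : S → A) (q : S × A → ℝ) :
    policyMat π *ᵥ q = fun s => q (s, π s) := by
  funext s
  simp [policyMat, Matrix.mulVec, dotProduct]

variable [Nonempty A]

theorem norm_meanField_sub_le (hd : ∀ x, 0 ≤ d x) (hd1 : ∑ x, d x = 1)
    (θ θ' : EuclideanSpace ℝ (Fin m)) :
    ‖meanField M d Φ θ - meanField M d Φ θ'‖ ≤
      featureMax Φ * ((1 + M.γ) * (featureMax Φ * ‖θ - θ'‖)) := by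
  rw [meanField, meanField, ← WithLp.toLp_sub, ← Matrix.mulVec_sub]
  exact (norm_toLp_mulVec_le d Φ hd hd1 _).trans
    (mul_le_mul_of_nonneg_left (norm_bellman_residual_sub_le Φ M θ θ') (featureMax_nonneg Φ))

theorem lyapNorm_meanStep_sub_le {α ε : ℝ} (hε : 0 < ε) (θ θ' : EuclideanSpace ℝ (Fin m)) :
    lyapNorm M d Φ α ε (meanStep M d Φ α θ - meanStep M d Φ α θ') ≤
      beta M d Φ α ε * lyapNorm M d Φ α ε (θ - θ') := by
  set x := θ - θ' with hx
  set W := Φᵀ * Matrix.diagonal d with hW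
  let z : EuclideanSpace ℝ (Fin m) := WithLp.toLp 2 (x.ofLp - α • ((W * Φ) *ᵥ x.ofLp))
  let ℓ : (S → ℝ) →ₗ[ℝ] EuclideanSpace ℝ (Fin m) :=
    (WithLp.linearEquiv 2 ℝ (Fin m → ℝ)).symm.toLinearMap ∘ₗ
      ((α * M.γ) • (W * transMat M)).mulVecLin
  have hℓ : ∀ v, ℓ v = WithLp.toLp 2 (((α * M.γ) • (W * transMat M)) *ᵥ v) := fun v => rfl
  have hconv : ConvexOn ℝ Set.univ fun v => lyapNorm M d Φ α ε (z + ℓ v) :=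
    ((convexOn_lyapNorm M d Φ hε).translate_right z).comp_linearMap ℓ
  -- Hulls commute with products, so the statewise inclusions combine. A point of the product itself
  -- chooses one action per state, that is, a deterministic policy.
  have hmem : valueFun Φ θ - valueFun Φ θ' ∈
      convexHull ℝ (Set.univ.pi fun s => Set.range fun a => qFun Φ x (s, a)) := by
    rw [convexHull_pi]
    exact fun s _ => valueFun_sub_mem_convexHull Φ θ θ' s
  -- The step depends affinely on the value difference, so its Lyapunov norm is convex there and is
  -- dominated at one of these policy points.
  obtain ⟨v, hv, hle⟩ := hconv.exists_ge_of_mem_convexHull (Set.subset_univ _) hmem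
  choose π hπ using fun s => hv s (Set.mem_univ s)
  have hstep : meanStep M d Φ α θ - meanStep M d Φ α θ' =
      z + ℓ (valueFun Φ θ - valueFun Φ θ') := by
    apply (WithLp.equiv 2 _).injective
    simp only [meanStep, meanField, hℓ, z, hx, hW, WithLp.equiv_apply,
      WithLp.ofLp_sub, WithLp.ofLp_add, WithLp.ofLp_smul, bellman, qFun, Matrix.mulVec_sub, Matrix.mulVec_add,
      Matrix.mulVec_smul, Matrix.smul_mulVec, ← Matrix.mulVec_mulVec, mul_smul, smul_sub, smul_add]
    abel
  have hmode : z + ℓ v = act (mode M d Φ α π) x := by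
    have hv' : v = policyMat π *ᵥ (Φ *ᵥ x.ofLp) := by
      rw [policyMat_mulVec]
      exact funext fun s => (hπ s).symm
    apply (WithLp.equiv 2 _).injective
    simp only [act, mode, hℓ, z, hv', WithLp.equiv_apply, WithLp.ofLp_add, Matrix.add_mulVec,
      Matrix.sub_mulVec, Matrix.one_mulVec, Matrix.smul_mulVec, ← Matrix.mulVec_mulVec, ← hW]
  rw [hstep]
  refine hle.trans ?_
  rw [hmode]
  exact lyapNorm_act_mode_le M d Φ hε π x

theorem lyapNorm_iterate_meanStep_sub_le {α ε : ℝ} (hε : 0 < ε) (n : ℕ)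
    (θ θ' : EuclideanSpace ℝ (Fin m)) :
    lyapNorm M d Φ α ε ((meanStep M d Φ α)^[n] θ - (meanStep M d Φ α)^[n] θ') ≤
      beta M d Φ α ε ^ n * lyapNorm M d Φ α ε (θ - θ') := by
  induction n with
  | zero => simp
  | succ n ih =>
    rw [Function.iterate_succ_apply', Function.iterate_succ_apply', pow_succ', mul_assoc]
    exact (lyapNorm_meanStep_sub_le M d Φ hε _ _).trans
      (mul_le_mul_of_nonneg_left ih (beta_pos M d Φ hε).le)

theorem existsUnique_isProjectedFixedPoint (hΦ : Φ.rank = m) (hd : ∀ x, 0 < d x) {α ε : ℝ}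
    (hα : 0 < α) (hε : 0 < ε) (hβ : beta M d Φ α ε < 1) :
    ∃! θ, IsProjectedFixedPoint M d Φ θ := by
  have hβ0 := beta_pos M d Φ (α := α) hε
  simp only [isProjectedFixedPoint_iff M d Φ hΦ hd, ← isFixedPt_meanStep_iff M d Φ hα]
  obtain ⟨C, hC⟩ := exists_isEquivConst M d Φ (α := α) hε
  have hlim : Tendsto (fun n => beta M d Φ α ε ^ n * √C) atTop (𝓝 (0 * √C)) :=
    (tendsto_pow_atTop_nhds_zero_of_lt_one hβ0.le hβ).mul_const _
  rw [zero_mul] at hlim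
  obtain ⟨n, hn⟩ := (hlim.eventually_lt_const one_pos).exists
  -- The contraction is in the Lyapunov norm. Passing to the Euclidean norm costs a factor `√C`,
  -- which a high enough iterate absorbs; the fixed point of that iterate is fixed by the map
  -- itself.
  have hcontr : ContractingWith (NNReal.mk (beta M d Φ α ε ^ n * √C) (by positivity))
      (meanStep M d Φ α)^[n] := by
    refine ⟨by exact_mod_cast hn, LipschitzWith.of_dist_le_mul fun θ θ' => ?_⟩
    rw [dist_eq_norm, dist_eq_norm]
    refine (norm_le_lyapNorm M d Φ hε _).trans
      ((lyapNorm_iterate_meanStep_sub_le M d Φ hε n θ θ').trans ?_)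
    rw [NNReal.coe_mk, mul_assoc]
    exact mul_le_mul_of_nonneg_left (lyapNorm_le M d Φ hC _) (by positivity)
  refine ⟨_, hcontr.isFixedPt_fixedPoint_iterate, fun θ hθ => ?_⟩
  exact hcontr.fixedPoint_unique (hθ.iterate n)

end MeanField

end LinearQ

namespace LinearQ

/-! ### Sampled iterates along a path -/

section Iterates

variable {S A : Type*} [Fintype S] {m : ℕ} (M : MDP S A) (Φ : Matrix (S × A) (Fin m) ℝ)

theorem iterates_congr (α : ℝ) (θ₀ : EuclideanSpace ℝ (Fin m)) {x y : ℕ → S × A} {k : ℕ}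
    (h : ∀ j ≤ k, x j = y j) : iterates M Φ α θ₀ x k = iterates M Φ α θ₀ y k := by
  induction k with
  | zero => rfl
  | succ k ih =>
    simp only [iterates, ih fun j hj => h j (hj.trans k.le_succ), h k k.le_succ, h (k + 1) le_rfl]

variable [Fintype A]

/-- A function of the iterates takes finitely many values, hence is integrable. -/
theorem integrable_comp_iterates {Ω : Type*} [MeasurableSpace Ω] (ℙ : Measure Ω)
    [IsFiniteMeasure ℙ] {X : ℕ → Ω → S × A} (hX : ∀ k y, MeasurableSet {ω | X k ω = y})
    (α : ℝ) (θ₀ : EuclideanSpace ℝ (Fin m)) (k : ℕ) (f : EuclideanSpace ℝ (Fin m) → ℝ) :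
    Integrable (fun ω => f (iterates M Φ α θ₀ (fun j => X j ω) k)) ℙ := by
  let _ : MeasurableSpace (S × A) := ⊤
  -- The finite path is extended periodically; by `iterates_congr` only its first `k + 1` entries
  -- matter.
  let g : (Fin (k + 1) → S × A) → ℝ := fun z => f (iterates M Φ α θ₀ (fun j => z (Fin.ofNat _ j)) k)
  let Z : Ω → Fin (k + 1) → S × A := fun ω j => X j ω
  have hZ : Measurable Z :=
    measurable_pi_lambda _ fun j => measurable_to_countable' fun y => hX j y
  have hg : Integrable g (ℙ.map Z) := Integrable.of_finite
  refine (hg.comp_measurable hZ).congr (Eventually.of_forall fun ω => congrArg f ?_)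
  refine iterates_congr M Φ α θ₀ fun j hj => ?_
  simp [Z, Nat.mod_eq_of_lt (Nat.lt_succ_of_le hj)]

theorem le_pow_mul_add_of_le_mul_add {u : ℕ → ℝ} {l c : ℝ} (hl : 0 ≤ l)
    (h : ∀ k, u (k + 1) ≤ l * u k + c) (k : ℕ) :
    u k ≤ l ^ k * u 0 + c * ∑ j ∈ Finset.range k, l ^ j := by
  induction k with
  | zero => simp
  | succ k ih =>
    refine (h k).trans ?_
    rw [Finset.sum_range_succ', pow_zero]
    simp only [pow_succ', ← Finset.mul_sum]
    nlinarith [mul_le_mul_of_nonneg_left ih hl]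

theorem residual_nonneg {α : ℝ} (hα : 0 ≤ α) (C : ℝ) (θ : EuclideanSpace ℝ (Fin m)) :
    0 ≤ residual M Φ α C θ := by
  have := featureMax_nonneg Φ
  have := rewardMax_nonneg M
  have := M.γ_pos
  unfold residual
  positivity

variable [Nonempty A]

theorem abs_tdError_le (θ θs : EuclideanSpace ℝ (Fin m)) (x y : S × A) :
    |M.r x.1 x.2 y.1 + M.γ * valueFun Φ θ y.1 - qFun Φ θ x| ≤
      rewardMax M + (1 + M.γ) * (‖qFun Φ θs‖ + featureMax Φ * ‖θ - θs‖) := by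
  have hq : ‖qFun Φ θ‖ ≤ ‖qFun Φ θs‖ + featureMax Φ * ‖θ - θs‖ := by
    have h : qFun Φ θ = qFun Φ θs + qFun Φ (θ - θs) := by rw [qFun_sub]; abel
    rw [h]
    exact (norm_add_le _ _).trans (add_le_add_right (norm_qFun_le Φ _) _)
  have hr := abs_reward_le M x.1 x.2 y.1
  have hv := mul_le_mul_of_nonneg_left ((abs_valueFun_le Φ θ y.1).trans hq) M.γ_pos.le
  have hx : |qFun Φ θ x| ≤ _ := (norm_le_pi_norm (qFun Φ θ) x).trans hq
  calc _ ≤ |M.r x.1 x.2 y.1| + M.γ * |valueFun Φ θ y.1| + |qFun Φ θ x| := by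
        refine (abs_sub _ _).trans (add_le_add_left ((abs_add_le _ _).trans_eq ?_) _)
        rw [abs_mul, abs_of_pos M.γ_pos]
    _ ≤ _ := by linarith

variable [DecidableEq S] [DecidableEq A] (d : S × A → ℝ)

theorem lam_nonneg {α ε : ℝ} (hα : 0 ≤ α) (hε : 0 < ε) (C : ℝ) : 0 ≤ lam M d Φ α ε C := by
  have := featureMax_nonneg Φ
  have := M.γ_pos
  have := beta_pos M d Φ (α := α) hε
  unfold lam
  positivity

/-- One step of the recursion contracts in the Lyapunov norm up to the factor `lam` and the
additive constant `residual`, along every path. -/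
theorem lyapNorm_iterates_succ_le (hΦ : Φ.rank = m) (hd : ∀ x, 0 < d x) (hd1 : ∑ x, d x = 1)
    {α ε C : ℝ} (hα : 0 < α) (hε : 0 < ε) (hC : IsEquivConst M d Φ α ε C)
    {θs : EuclideanSpace ℝ (Fin m)} (hθs : IsProjectedFixedPoint M d Φ θs)
    (θ₀ : EuclideanSpace ℝ (Fin m)) (x : ℕ → S × A) (k : ℕ) :
    lyapNorm M d Φ α ε (iterates M Φ α θ₀ x (k + 1) - θs) ≤
      lam M d Φ α ε C * lyapNorm M d Φ α ε (iterates M Φ α θ₀ x k - θs) +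
        residual M Φ α C θs := by
  have hfix := (isProjectedFixedPoint_iff M d Φ hΦ hd θs).1 hθs
  set θ := iterates M Φ α θ₀ x k with hθ
  set δ := M.r (x k).1 (x k).2 (x (k + 1)).1 + M.γ * valueFun Φ θ (x (k + 1)).1 - qFun Φ θ (x k)
    with hδ
  -- The mean field vanishes at `θs`, so `θs` is its own averaged step.
  have hsplit : iterates M Φ α θ₀ x (k + 1) - θs =
      (meanStep M d Φ α θ - meanStep M d Φ α θs) +
        α • (δ • feature Φ (x k) - meanField M d Φ θ) := by
    have hsucc : iterates M Φ α θ₀ x (k + 1) = θ + (α * δ) • feature Φ (x k) := rfl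
    rw [hsucc, meanStep, meanStep, hfix, smul_zero, smul_sub, mul_smul]
    abel
  set f := featureMax Φ with hf
  set n := ‖θ - θs‖ with hn
  set p := lyapNorm M d Φ α ε (θ - θs) with hp
  have hf0 : 0 ≤ f := featureMax_nonneg Φ
  have hγ := M.γ_pos
  have hnp : n ≤ p := norm_le_lyapNorm M d Φ hε _
  have hmean : ‖meanField M d Φ θ‖ ≤ f * ((1 + M.γ) * (f * n)) := by
    simpa [hfix] using norm_meanField_sub_le M d Φ (fun x => (hd x).le) hd1 θ θs
  have hsample : ‖δ • feature Φ (x k)‖ ≤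
      (rewardMax M + (1 + M.γ) * (‖qFun Φ θs‖ + f * n)) * f := by
    rw [norm_smul, Real.norm_eq_abs]
    exact mul_le_mul (abs_tdError_le M Φ θ θs (x k) (x (k + 1))) (norm_feature_le Φ _)
      (norm_nonneg _) ((abs_nonneg _).trans (abs_tdError_le M Φ θ θs (x k) (x (k + 1))))
  have hnoise : lyapNorm M d Φ α ε (α • (δ • feature Φ (x k) - meanField M d Φ θ)) ≤
      α * (√C * ((rewardMax M + (1 + M.γ) * (‖qFun Φ θs‖ + f * n)) * f +
        f * ((1 + M.γ) * (f * n)))) := by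
    rw [lyapNorm_smul M d Φ hε, abs_of_pos hα]
    refine mul_le_mul_of_nonneg_left ((lyapNorm_le M d Φ hC _).trans ?_) hα.le
    exact mul_le_mul_of_nonneg_left
      ((norm_sub_le _ _).trans (add_le_add hsample hmean)) (Real.sqrt_nonneg C)
  rw [hsplit]
  refine (lyapNorm_add_le M d Φ hε _ _).trans
    ((add_le_add (lyapNorm_meanStep_sub_le M d Φ hε θ θs) hnoise).trans ?_)
  -- The sampled and the mean direction each contribute one such term. The `4` in `lam`, the `2` in
  -- `residual` and its Bellman residual term leave slack, which `h2`, `h3` and `h4` show to be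
  -- nonnegative.
  have h1 : α * √C * (1 + M.γ) * f ^ 2 * n ≤ α * √C * (1 + M.γ) * f ^ 2 * p := by gcongr
  have h2 : 0 ≤ α * √C * (1 + M.γ) * f ^ 2 * p :=
    mul_nonneg (by positivity) (Real.sqrt_nonneg _)
  have h3 : 0 ≤ α * √C * f * (rewardMax M + (1 + M.γ) * ‖qFun Φ θs‖) := by
    have := rewardMax_nonneg M
    positivity
  have h4 : 0 ≤ α * √C * f * ‖bellman M Φ θs - qFun Φ θs‖ := by positivity
  rw [lam, residual, ← hp, ← hf]
  linarith

end Iterates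

end LinearQ

/-! ### Expectations and the final bounds -/

open LinearQ

theorem theorem4 {S A Ω : Type*} [Fintype S] [Fintype A] [DecidableEq S] [DecidableEq A]
    [Nonempty S] [Nonempty A] {m : ℕ}
    (M : LinearQ.MDP S A) (Φ : Matrix (S × A) (Fin m) ℝ) (hΦ : Φ.rank = m)
    (b : S → A → ℝ) (hb : LinearQ.IsPolicy b)
    (d : S × A → ℝ) (hd : LinearQ.IsStationary M b d) (hd_pos : ∀ x, 0 < d x)
    (α : ℝ) (hα0 : 0 < α) (hα1 : α < 1)
    (hρ : LinearQ.rhoDir M d Φ α < 1)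
    (ε : ℝ) (hε : 0 < ε) (hβ : LinearQ.beta M d Φ α ε < 1)
    [MeasurableSpace Ω] (ℙ : Measure Ω) [IsProbabilityMeasure ℙ]
    (X : ℕ → Ω → S × A) (hX : LinearQ.IsTrajectory ℙ M b X)
    (θ₀ : EuclideanSpace ℝ (Fin m))
    (θ : ℕ → Ω → EuclideanSpace ℝ (Fin m))
    (hθ : ∀ k ω, θ k ω = LinearQ.iterates M Φ α θ₀ (fun j => X j ω) k) :
    -- the Lyapunov norm, the constant `C_ε` and the fixed point `θ⋆` are well defined
    (∀ x, Tendsto (fun t => LinearQ.lyapPartial M d Φ α ε t x) atTop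
      (𝓝 (LinearQ.lyap M d Φ α ε x))) ∧
    LinearQ.IsNorm (LinearQ.lyapNorm M d Φ α ε) ∧
    (∃ C, LinearQ.IsEquivConst M d Φ α ε C) ∧
    (∃! θs, LinearQ.IsProjectedFixedPoint M d Φ θs) ∧
    ∀ C, LinearQ.IsEquivConst M d Φ α ε C →
    ∀ θs, LinearQ.IsProjectedFixedPoint M d Φ θs →
      -- all expectations below are finite
      (∀ k, Integrable (fun ω => LinearQ.lyapNorm M d Φ α ε (θ k ω - θs)) ℙ ∧
        Integrable (fun ω => ‖θ k ω - θs‖) ℙ ∧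
        Integrable (fun ω => ‖LinearQ.act Φ (θ k ω) - LinearQ.act Φ θs‖) ℙ) ∧
      -- finite-time bounds, whatever the value of `λ_ε`
      (∀ k,
        ∫ ω, LinearQ.lyapNorm M d Φ α ε (θ k ω - θs) ∂ℙ ≤
            LinearQ.lam M d Φ α ε C ^ k * LinearQ.lyapNorm M d Φ α ε (θ₀ - θs)
            + LinearQ.residual M Φ α C θs
              * ∑ j ∈ Finset.range k, LinearQ.lam M d Φ α ε C ^ j ∧
        ∫ ω, ‖θ k ω - θs‖ ∂ℙ ≤
            √C * LinearQ.lam M d Φ α ε C ^ k * ‖θ₀ - θs‖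
            + LinearQ.residual M Φ α C θs
              * ∑ j ∈ Finset.range k, LinearQ.lam M d Φ α ε C ^ j ∧
        ∫ ω, ‖LinearQ.act Φ (θ k ω) - LinearQ.act Φ θs‖ ∂ℙ ≤
            LinearQ.specNorm Φ * (√C * LinearQ.lam M d Φ α ε C ^ k * ‖θ₀ - θs‖
            + LinearQ.residual M Φ α C θs
              * ∑ j ∈ Finset.range k, LinearQ.lam M d Φ α ε C ^ j)) ∧
      -- the bounds under the condition `λ_ε < 1`
      (LinearQ.lam M d Φ α ε C < 1 →
        (∀ k, ∫ ω, LinearQ.lyapNorm M d Φ α ε (θ k ω - θs) ∂ℙ ≤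
            LinearQ.lam M d Φ α ε C ^ k * LinearQ.lyapNorm M d Φ α ε (θ₀ - θs)
            + LinearQ.residual M Φ α C θs / (1 - LinearQ.lam M d Φ α ε C)
              * (1 - LinearQ.lam M d Φ α ε C ^ k)) ∧
        (∀ k, ∫ ω, ‖θ k ω - θs‖ ∂ℙ ≤
            √C * LinearQ.lam M d Φ α ε C ^ k * ‖θ₀ - θs‖
            + LinearQ.residual M Φ α C θs / (1 - LinearQ.lam M d Φ α ε C)) ∧
        limsup (fun k => ∫ ω, ‖θ k ω - θs‖ ∂ℙ) atTop ≤
            LinearQ.residual M Φ α C θs / (1 - LinearQ.lam M d Φ α ε C) ∧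
        (∀ k, ∫ ω, ‖LinearQ.act Φ (θ k ω) - LinearQ.act Φ θs‖ ∂ℙ ≤
            LinearQ.specNorm Φ * (√C * LinearQ.lam M d Φ α ε C ^ k * ‖θ₀ - θs‖
            + LinearQ.residual M Φ α C θs / (1 - LinearQ.lam M d Φ α ε C)))) := by
  simp only [hθ]
  refine ⟨tendsto_lyapPartial M d Φ hε, isNorm_lyapNorm M d Φ hε, exists_isEquivConst M d Φ hε,
    existsUnique_isProjectedFixedPoint M d Φ hΦ hd_pos hα0 hε hβ, fun C hC θs hθs => ?_⟩
  have hint := fun k (f : EuclideanSpace ℝ (Fin m) → ℝ) =>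
    integrable_comp_iterates M Φ ℙ hX.1 α θ₀ k f
  have hp := fun k => hint k fun θ => lyapNorm M d Φ α ε (θ - θs)
  have hn := fun k => hint k fun θ => ‖θ - θs‖
  have ha := fun k => hint k fun θ => ‖act Φ θ - act Φ θs‖
  have hl := lam_nonneg M Φ d hα0.le hε C
  have hc := residual_nonneg M Φ hα0.le C θs
  set l := lam M d Φ α ε C
  set c := residual M Φ α C θs
  have hpk : ∀ k, ∫ ω, lyapNorm M d Φ α ε (iterates M Φ α θ₀ (fun j => X j ω) k - θs) ∂ℙ ≤
      l ^ k * lyapNorm M d Φ α ε (θ₀ - θs) + c * ∑ j ∈ Finset.range k, l ^ j := by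
    have hstep : ∀ k,
        ∫ ω, lyapNorm M d Φ α ε (iterates M Φ α θ₀ (fun j => X j ω) (k + 1) - θs) ∂ℙ ≤
        l * ∫ ω, lyapNorm M d Φ α ε (iterates M Φ α θ₀ (fun j => X j ω) k - θs) ∂ℙ + c := by
      intro k
      refine (integral_mono (hp (k + 1)) (((hp k).const_mul l).add (integrable_const c))
        fun ω => lyapNorm_iterates_succ_le M Φ d hΦ hd_pos hd.2.1 hα0 hε hC hθs θ₀ _ k).trans_eq ?_
      simp only [Pi.add_apply]
      rw [integral_add ((hp k).const_mul l) (integrable_const c), integral_const_mul]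
      simp
    intro k
    refine (le_pow_mul_add_of_le_mul_add (u := fun k =>
      ∫ ω, lyapNorm M d Φ α ε (iterates M Φ α θ₀ (fun j => X j ω) k - θs) ∂ℙ)
      hl hstep k).trans_eq ?_
    simp [iterates]
  have hnk : ∀ k, ∫ ω, ‖iterates M Φ α θ₀ (fun j => X j ω) k - θs‖ ∂ℙ ≤
      √C * l ^ k * ‖θ₀ - θs‖ + c * ∑ j ∈ Finset.range k, l ^ j := by
    intro k
    refine (integral_mono (hn k) (hp k) fun ω => norm_le_lyapNorm M d Φ hε _).trans
      ((hpk k).trans (add_le_add_left ?_ _))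
    refine (mul_le_mul_of_nonneg_left (lyapNorm_le M d Φ hC _) (pow_nonneg hl k)).trans_eq ?_
    ring
  have hak : ∀ k, ∫ ω, ‖act Φ (iterates M Φ α θ₀ (fun j => X j ω) k) - act Φ θs‖ ∂ℙ ≤
      specNorm Φ * ∫ ω, ‖iterates M Φ α θ₀ (fun j => X j ω) k - θs‖ ∂ℙ := by
    intro k
    rw [← integral_const_mul]
    refine integral_mono (ha k) ((hn k).const_mul _) fun ω => ?_
    simp only [← act_sub]
    exact norm_act_le Φ _
  refine ⟨fun k => ⟨hp k, hn k, ha k⟩, fun k => ⟨hpk k, hnk k, (hak k).trans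
    (mul_le_mul_of_nonneg_left (hnk k) (specNorm_nonneg Φ))⟩, fun hl1 => ?_⟩
  have hgeom : ∀ k, c * ∑ j ∈ Finset.range k, l ^ j = c / (1 - l) * (1 - l ^ k) := by
    intro k
    have hne : 1 - l ≠ 0 := (sub_pos.2 hl1).ne'
    rw [div_mul_eq_mul_div, eq_div_iff hne, mul_assoc, geom_sum_mul_neg]
  have hnk' : ∀ k, ∫ ω, ‖iterates M Φ α θ₀ (fun j => X j ω) k - θs‖ ∂ℙ ≤
      √C * l ^ k * ‖θ₀ - θs‖ + c / (1 - l) := by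
    intro k
    refine (hnk k).trans (add_le_add_right ?_ _)
    rw [hgeom]
    exact mul_le_of_le_one_right (div_nonneg hc (sub_pos.2 hl1).le)
      (sub_le_self _ (pow_nonneg hl k))
  refine ⟨fun k => (hpk k).trans_eq (by rw [hgeom]), hnk', ?_, fun k => (hak k).trans
    (mul_le_mul_of_nonneg_left (hnk' k) (specNorm_nonneg Φ))⟩
  have hlim : Tendsto (fun k => √C * l ^ k * ‖θ₀ - θs‖ + c / (1 - l)) atTop (𝓝 (c / (1 - l))) := by
    have h := (((tendsto_pow_atTop_nhds_zero_of_lt_one hl hl1).const_mul √C).mul_const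
      ‖θ₀ - θs‖).add_const (c / (1 - l))
    simpa using h
  rw [← hlim.limsup_eq]
  refine limsup_le_limsup (Eventually.of_forall hnk') ?_ hlim.isBoundedUnder_le
  -- A real `limsup` is monotone only with boundedness side conditions; here the integrals are
  -- bounded below by `0`.
  exact IsBoundedUnder.isCoboundedUnder_le
    (isBoundedUnder_of ⟨0, fun k => integral_nonneg fun ω => norm_nonneg _⟩)
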